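/- Complex manifolds are Hausdorff, second countable and of pure dimension, but need not be connected. Let $M_0$ be a complex manifold of dimension $N$ and let $1\le n\le N$. An $n$-dimensional complex submanifold of $M_0$ is a subset $S\subset M_0$ (embedded, not necessarily closed or connected) such that around each point of $S$ there is a holomorphic chart of $M_0$ in which $S$ is given by the vanishing of the last $N-n$ coordinates. For $x\in M_0$, two such submanifolds $S_1,S_2\ni x$ have the same germ at $x$ if $S_1\cap W=S_2\cap W$ for some neighbourhood $W$ of $x$ in $M_0$; $[S]_x$ denotes the germ of $S$ at $x$. Let $\mathcal S^n$ be the set of all germs $[S]_x$ with $x\in S$, with the topology generated by the sets $V_S=\{[S]_x : x\in S\}$, and let $\sigma:\mathcal S^n\to M_0$, $[S]_x\mapsto x$. For a topological space $X$ the connected components of $X$ are called its leaves. **Theorem.** The map $\sigma$ is continuous, and the pair $(X,\tau)=(\mathcal S^n,\sigma)$ has the following two properties: 1. Each leaf $\mathcal L$ of $X$ (with the subspace topology) admits a structure of $n$-dimensional complex manifold such that $\tau|_{\mathcal L}$ is a holomorphic immersion. 2. For every $n$-dimensional complex manifold $M$ and every holomorphic immersion $\phi:M\to M_0$ there is a unique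 continuous map $\rho_\phi:M\to X$ such that $\phi=\tau\circ\rho_\phi$. Moreover, the leaves of $\mathcal S^n$ are open. Up to equivalence, $(\mathcal S^n,\sigma)$ is the only such pair: if $X$ is a topological space and $\tau:X\to M_0$ is a continuous map with properties 1 and 2, then there is a continuous bijection $e:\mathcal S^n\to X$ with $\sigma=\tau\circ e$ which maps each leaf of $\mathcal S^n$ biholomorphically onto a leaf of $X$ (for any complex structures as in 1 on the two leaves). If moreover the leaves of $X$ are open in $X$, then $e$ is a homeomorphism. -/

import Mathlib

open scoped Manifold ContDiff Topology

universe u v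

/-- The model space `ℂ^k`. -/
abbrev CSpace (k : ℕ) : Type := EuclideanSpace ℂ (Fin k)

/-- `S` is an (embedded, not necessarily closed or connected) `n`-dimensional complex submanifold
of the `N`-dimensional complex manifold `M₀`: around each of its points there is a holomorphic
chart of `M₀` in which `S` is the slice where the last `N - n` coordinates vanish. -/
def IsComplexSubmanifold (N n : ℕ) {M₀ : Type*} [TopologicalSpace M₀] [ChartedSpace (CSpace N) M₀]
    (S : Set M₀) : Prop :=
  ∀ p ∈ S, ∃ ψ ∈ IsManifold.maximalAtlas 𝓘(ℂ, CSpace N) ω M₀, p ∈ ψ.source ∧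
    ∀ q ∈ ψ.source, (q ∈ S ↔ ∀ i : Fin N, n ≤ (i : ℕ) → ψ q i = 0)

/-- The `n`-dimensional complex submanifolds of `M₀` passing through `x`. -/
def SubmanifoldThrough (N n : ℕ) {M₀ : Type*} [TopologicalSpace M₀] [ChartedSpace (CSpace N) M₀]
    (x : M₀) : Type _ :=
  {S : Set M₀ // IsComplexSubmanifold N n S ∧ x ∈ S}

/-- Two submanifolds through `x` are equivalent if they coincide in a neighbourhood of `x`. -/
def germSetoid (N n : ℕ) {M₀ : Type*} [TopologicalSpace M₀] [ChartedSpace (CSpace N) M₀]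
    (x : M₀) : Setoid (SubmanifoldThrough N n x) where
  r S₁ S₂ := ∃ W ∈ 𝓝 x, S₁.1 ∩ W = S₂.1 ∩ W
  iseqv :=
    { refl := fun _ => ⟨Set.univ, Filter.univ_mem, rfl⟩
      symm := fun ⟨W, hW, h⟩ => ⟨W, hW, h.symm⟩
      trans := by
        rintro S₁ S₂ S₃ ⟨W, hW, h⟩ ⟨W', hW', h'⟩
        refine ⟨W ∩ W', Filter.inter_mem hW hW', ?_⟩
        rw [← Set.inter_assoc, h, Set.inter_right_comm, h', Set.inter_right_comm, Set.inter_assoc] }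

/-- The space of germs of `n`-dimensional complex submanifolds of `M₀`: a point is a point `x`
of `M₀` together with a germ at `x`. -/
def GermSpace (N n : ℕ) (M₀ : Type*) [TopologicalSpace M₀] [ChartedSpace (CSpace N) M₀] : Type _ :=
  Σ x : M₀, Quotient (germSetoid N n x)

namespace GermSpace

variable {N n : ℕ} {M₀ : Type*} [TopologicalSpace M₀] [ChartedSpace (CSpace N) M₀]

/-- The natural projection `σ`, sending a germ at `x` to `x`. -/
def proj (s : GermSpace N n M₀) : M₀ := s.1

/-- The germ `[S]_x`. -/
def germ (S : Set M₀) (hS : IsComplexSubmanifold N n S) (x : M₀) (hx : x ∈ S) :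
    GermSpace N n M₀ :=
  ⟨x, Quotient.mk (germSetoid N n x) ⟨S, hS, hx⟩⟩

/-- The set `V_S` of all germs `[S]_x` with `x ∈ S`. -/
def germsOf (S : Set M₀) (hS : IsComplexSubmanifold N n S) : Set (GermSpace N n M₀) :=
  {s | ∃ (x : M₀) (hx : x ∈ S), s = germ S hS x hx}

/-- The canonical topology, generated by the sets `V_S`. -/
instance : TopologicalSpace (GermSpace N n M₀) :=
  TopologicalSpace.generateFrom
    {V | ∃ (S : Set M₀) (hS : IsComplexSubmanifold N n S), V = germsOf S hS}

end GermSpace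

/-- A structure of `n`-dimensional complex manifold (Hausdorff and second countable, compatible with
the subspace topology) on a subset `L` of `X`, for which the restriction of `τ : X → M₀` to `L` is a
holomorphic immersion. -/
structure LeafStructure (N n : ℕ) {M₀ X : Type*} [TopologicalSpace M₀] [ChartedSpace (CSpace N) M₀]
    [TopologicalSpace X] (τ : X → M₀) (L : Set X) where
  t2 : T2Space L
  secondCountable : SecondCountableTopology L
  [charted : ChartedSpace (CSpace n) L]
  isManifold : IsManifold 𝓘(ℂ, CSpace n) ω L
  isImmersion : Manifold.IsImmersion 𝓘(ℂ, CSpace n) 𝓘(ℂ, CSpace N) ω (fun p : L => τ p)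

/-- The two properties of the pair `(X, τ)`, where `τ : X → M₀` is continuous. The universe `t` is
that of the manifolds `M` in the second property. -/
structure IsUniversalLeafSpace.{t, a, b} (N n : ℕ) {M₀ : Type a} {X : Type b} [TopologicalSpace M₀]
    [ChartedSpace (CSpace N) M₀] [TopologicalSpace X] (τ : X → M₀) : Prop where
  continuous : Continuous τ
  /-- Each leaf is an `n`-dimensional complex manifold immersed by `τ`. -/
  leaf : ∀ s : X, Nonempty (LeafStructure N n τ (connectedComponent s))
  /-- Holomorphic immersions of `n`-dimensional complex manifolds lift uniquely. -/
  lift : ∀ (M : Type t) [TopologicalSpace M] [T2Space M] [SecondCountableTopology M]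
    [ChartedSpace (CSpace n) M] [IsManifold 𝓘(ℂ, CSpace n) ω M] (φ : M → M₀),
    Manifold.IsImmersion 𝓘(ℂ, CSpace n) 𝓘(ℂ, CSpace N) ω φ →
      ∃! ρ : M → X, Continuous ρ ∧ φ = τ ∘ ρ

/-- `e` is an equivalence from `(X, τ)` to `(Y, τ')`: a continuous bijection over `M₀` that
maps each leaf of `X` biholomorphically onto a leaf of `Y`, whichever complex structures, as in
`LeafStructure`, these leaves are given. -/
structure IsLeafEquivalence (N n : ℕ) {M₀ X Y : Type*} [TopologicalSpace M₀]
    [ChartedSpace (CSpace N) M₀] [TopologicalSpace X] [TopologicalSpace Y]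
    (τ : X → M₀) (τ' : Y → M₀) (e : X → Y) : Prop where
  continuous : Continuous e
  bijective : Function.Bijective e
  comp_eq : τ = τ' ∘ e
  biholomorphic : ∀ (s : X) (A : LeafStructure N n τ (connectedComponent s))
    (B : LeafStructure N n τ' (connectedComponent (e s))),
    letI := A.charted
    letI := B.charted
    ∃ d : Diffeomorph 𝓘(ℂ, CSpace n) 𝓘(ℂ, CSpace n) (connectedComponent s)
      (connectedComponent (e s)) ω, ∀ p, (d p : Y) = e p

/-!
The germ `[S]_x` is determined by the filter `𝓝[S] x`. By the identity theorem, if the slice of one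
chart agrees with the slice of another near points accumulating at `x`, then near `x` the first
slice is contained in the second one, and since the dimensions are equal the germs at `x` coincide.
Hence the germs of a slice form a relatively closed subset of the germs over the domain of its
chart. It follows that the germ space is Hausdorff, and, by the Poincaré–Volterra argument, that its
leaves are second countable.

An immersion `φ` is locally a diffeomorphism onto a slice, so a lift of `φ` must send `p` to the
germ whose filter is `map φ (𝓝 p)`, and this does define a continuous lift. For uniqueness of the
pair, lifting the leaves of two such spaces to each other gives mutually inverse maps, which are
continuous on each leaf.
-/

section PoincareVolterra

open Set TopologicalSpace Relation

theorem countable_setOf_reflTransGen {α : Type*} {r : α → α → Prop}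
    (hr : ∀ a, {b | r a b}.Countable) (a : α) : {b | ReflTransGen r a b}.Countable := by
  let reach (k : ℕ) : Set α := (fun S => ⋃ b ∈ S, {c | r b c})^[k] {a}
  have hreach : ∀ k, (reach k).Countable := fun k => by
    induction k with
    | zero => exact countable_singleton a
    | succ k ih =>
      simp only [reach, Function.iterate_succ_apply']
      exact ih.biUnion fun b _ => hr b
  refine (countable_iUnion hreach).mono fun b hab => mem_iUnion.2 ?_
  induction hab with
  | refl => exact ⟨0, rfl⟩
  | tail _ hbc ih =>
    obtain ⟨k, hk⟩ := ih
    refine ⟨k + 1, ?_⟩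
    simp only [reach, Function.iterate_succ_apply']
    exact mem_biUnion hk hbc

variable {X Y : Type*} [TopologicalSpace X] [TopologicalSpace Y]

theorem exists_countable_isClopen_biUnion {ι : Type*} {V : ι → Set X} (hV : ∀ i, IsOpen (V i))
    (hcover : ⋃ i, V i = univ) (hcount : ∀ i, {j | (V i ∩ V j).Nonempty}.Countable) (i : ι) :
    ∃ D : Set ι, D.Countable ∧ i ∈ D ∧ IsClopen (⋃ j ∈ D, V j) := by
  let meets (j k : ι) : Prop := (V j ∩ V k).Nonempty
  refine ⟨{j | ReflTransGen meets i j}, countable_setOf_reflTransGen hcount i, .refl,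
    isClosed_of_closure_subset fun x hx => ?_, isOpen_biUnion fun j _ => hV j⟩
  obtain ⟨k, hk⟩ := mem_iUnion.1 (hcover.symm ▸ mem_univ x)
  obtain ⟨y, hyk, hyD⟩ := mem_closure_iff.1 hx (V k) (hV k) hk
  obtain ⟨j, hj, hyj⟩ := mem_iUnion₂.1 hyD
  exact mem_biUnion (ReflTransGen.tail hj ⟨y, hyj, hyk⟩) hk

theorem countable_setOf_connectedComponentIn_inter_nonempty [LocallyConnectedSpace X] {A U : Set X}
    (hA : IsSeparable A) (hU : IsOpen U) :
    {C | (∃ x, C = connectedComponentIn U x) ∧ (A ∩ C).Nonempty}.Countable := by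
  obtain ⟨D, hD, hAD⟩ := hA
  refine (hD.image (connectedComponentIn U)).mono ?_
  rintro _ ⟨⟨x, rfl⟩, y, hyA, hyC⟩
  obtain ⟨d, hdC, hdD⟩ := mem_closure_iff.1 (hAD hyA) _ hU.connectedComponentIn hyC
  exact ⟨d, hdD, connectedComponentIn_eq hdC |>.symm⟩

theorem secondCountableTopology_mono {A B : Set X} (hAB : A ⊆ B) [SecondCountableTopology B] :
    SecondCountableTopology A :=
  (Topology.IsEmbedding.inclusion hAB).secondCountableTopology

theorem secondCountableTopology_biUnion {ι : Type*} {D : Set ι} {V : ι → Set X} (hD : D.Countable)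
    (hV : ∀ i ∈ D, IsOpen (V i)) (hsc : ∀ i ∈ D, SecondCountableTopology (V i)) :
    SecondCountableTopology (⋃ i ∈ D, V i : Set X) := by
  have := hD.to_subtype
  have (i : D) : SecondCountableTopology ((↑) ⁻¹' V i : Set (⋃ i ∈ D, V i : Set X)) :=
    have := hsc i i.2
    (Topology.IsInducing.subtypeVal.restrictPreimage (V i)).secondCountableTopology
  refine secondCountableTopology_of_countable_cover
    (fun i : D => (hV i i.2).preimage continuous_subtype_val) (eq_univ_of_forall fun x => ?_)
  obtain ⟨i, hi, hx⟩ := mem_iUnion₂.1 x.2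
  exact mem_iUnion.2 ⟨⟨i, hi⟩, hx⟩

/-- A form of the Poincaré–Volterra theorem: each sheet of `f` over a basic open set meets only
countably many others, so a chain of overlapping sheets reaches only countably many of them. -/
theorem secondCountableTopology_connectedComponent_of_continuous [LocallyConnectedSpace X]
    [SecondCountableTopology Y] {f : X → Y} (hf : Continuous f)
    (hloc : ∀ x, ∃ U, IsOpen U ∧ f x ∈ U ∧
      SecondCountableTopology (connectedComponentIn (f ⁻¹' U) x)) (x : X) :
    SecondCountableTopology (connectedComponent x) := by
  let sheets : Set (Set X) := {V | SecondCountableTopology V ∧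
    ∃ U ∈ countableBasis Y, ∃ y, V = connectedComponentIn (f ⁻¹' U) y}
  have hopen : ∀ V : sheets, IsOpen (V : Set X) := by
    rintro ⟨_, -, U, hU, y, rfl⟩
    exact ((isOpen_of_mem_countableBasis hU).preimage hf).connectedComponentIn
  have hmem : ∀ y, ∃ V : sheets, y ∈ (V : Set X) := fun y => by
    obtain ⟨U, hU, hyU, _⟩ := hloc y
    obtain ⟨B, hB, hyB, hBU⟩ := (isBasis_countableBasis Y).exists_subset_of_mem_open hyU hU
    exact ⟨⟨_, secondCountableTopology_mono (connectedComponentIn_mono y (preimage_mono hBU)), B,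
      hB, y, rfl⟩, mem_connectedComponentIn hyB⟩
  have hcount : ∀ V : sheets, {W : sheets | ((V : Set X) ∩ W).Nonempty}.Countable := fun V => by
    have := V.2.1
    have hV : IsSeparable (V : Set X) := .of_subtype _
    refine (((countable_countableBasis Y).biUnion fun U hU =>
      countable_setOf_connectedComponentIn_inter_nonempty hV
        ((isOpen_of_mem_countableBasis hU).preimage hf)).preimage_of_injOn
          Subtype.val_injective.injOn).mono fun W hW => ?_
    obtain ⟨U, hU, y, hWy⟩ := W.2.2
    exact mem_biUnion hU ⟨⟨y, hWy⟩, hW⟩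
  obtain ⟨V, hxV⟩ := hmem x
  obtain ⟨D, hD, hVD, hclopen⟩ := exists_countable_isClopen_biUnion hopen
    (eq_univ_of_forall fun y => mem_iUnion.2 (hmem y)) hcount V
  have := secondCountableTopology_biUnion hD (fun V _ => hopen V) fun V _ => V.2.1
  exact secondCountableTopology_mono (hclopen.connectedComponent_subset (mem_biUnion hVD hxV))

end PoincareVolterra

section LeafwiseContinuous

open Set

variable {X Y Z : Type*} [TopologicalSpace X] [TopologicalSpace Y] [TopologicalSpace Z]

/-- A map is leafwise continuous if it is continuous on each connected component of its domain. This
is weaker than continuity when these components are not open. -/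
def LeafwiseContinuous (f : X → Y) : Prop :=
  ∀ x, ContinuousOn f (connectedComponent x)

namespace LeafwiseContinuous

variable {f : X → Y} {g : Y → Z}

theorem mapsTo (hf : LeafwiseContinuous f) (x : X) :
    MapsTo f (connectedComponent x) (connectedComponent (f x)) :=
  mapsTo_iff_image_subset.2 <| (isPreconnected_connectedComponent.image f (hf x)
    ).subset_connectedComponent (mem_image_of_mem f mem_connectedComponent)

theorem comp (hg : LeafwiseContinuous g) (hf : LeafwiseContinuous f) : LeafwiseContinuous (g ∘ f) :=
  fun x => (hg (f x)).comp (hf x) (hf.mapsTo x)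

theorem continuous (hf : LeafwiseContinuous f) (ho : ∀ x : X, IsOpen (connectedComponent x)) :
    Continuous f :=
  continuous_iff_continuousAt.2 fun x =>
    (hf x).continuousAt ((ho x).mem_nhds mem_connectedComponent)

end LeafwiseContinuous

theorem existsUnique_leafwiseContinuous_lift {B : Type*} {τ : X → B} {τ' : Y → B}
    (h : ∀ x : X, ∃! ρ : connectedComponent x → Y, Continuous ρ ∧ τ ∘ (↑) = τ' ∘ ρ) :
    ∃! f : X → Y, LeafwiseContinuous f ∧ τ = τ' ∘ f := by
  choose ρ hρ hunique using h
  have hrestrict : ∀ (x : X) (y : connectedComponent x),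
      ρ y ⟨y, mem_connectedComponent⟩ = ρ x y := fun x y => by
    let incl := inclusion (connectedComponent_eq y.2).ge
    have hincl : Continuous incl := continuous_inclusion _
    exact (congrFun (hunique y (ρ x ∘ incl) ⟨(hρ x).1.comp hincl,
      funext fun z => congrFun (hρ x).2 (incl z)⟩) ⟨y, mem_connectedComponent⟩).symm
  refine ⟨fun x => ρ x ⟨x, mem_connectedComponent⟩, ⟨fun x => ?_, ?_⟩, fun f hf => ?_⟩
  · rw [continuousOn_iff_continuous_domRestrict]
    convert (hρ x).1 using 1
    exact funext fun y => hrestrict x y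
  · exact funext fun x => congrFun (hρ x).2 ⟨x, mem_connectedComponent⟩
  · refine funext fun x => congrFun (hunique x (f ∘ (↑)) ⟨(hf.1 x).domRestrict, ?_⟩) ⟨x, _⟩
    exact funext fun y => congrFun hf.2 y

end LeafwiseContinuous

section Calculus

open Filter

variable {𝕜 E F : Type*} [NontriviallyNormedField 𝕜] [NormedAddCommGroup E] [NormedSpace 𝕜 E]
  [NormedAddCommGroup F] [NormedSpace 𝕜 F]

theorem injective_of_hasFDerivAt_of_eventually_leftInverse {f : E → F} {g : F → E}
    {f' : E →L[𝕜] F} {a : E} (hf : HasFDerivAt f f' a)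
    (hg : DifferentiableAt 𝕜 g (f a)) (h : ∀ᶠ x in 𝓝 a, g (f x) = x) :
    Function.Injective f' := by
  have hcomp : HasFDerivAt id (fderiv 𝕜 g (f a) ∘L f') a :=
    (hg.hasFDerivAt.comp a hf).congr_of_eventuallyEq (EventuallyEq.symm h)
  have hid : fderiv 𝕜 g (f a) ∘L f' = .id 𝕜 E := hcomp.unique (hasFDerivAt_id a)
  exact Function.LeftInverse.injective fun v => DFunLike.congr_fun hid v

theorem map_nhds_comp_eq_of_hasStrictFDerivAt_of_injective [CompleteSpace 𝕜] [FiniteDimensional 𝕜 E]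
    {f : E → F} {f' : E →L[𝕜] F} {a : E} (hf : HasStrictFDerivAt f f' a)
    (hf' : Function.Injective f') {i : E →L[𝕜] F} {π : F →L[𝕜] E}
    (h : ∀ᶠ x in 𝓝 a, i (π (f x)) = f x) : map (π ∘ f) (𝓝 a) = 𝓝 (π (f a)) := by
  have hd : HasFDerivAt f (i ∘L π ∘L f') a :=
    (i.hasFDerivAt.comp a (π.hasFDerivAt.comp a hf.hasFDerivAt)).congr_of_eventuallyEq
      (EventuallyEq.symm h)
  have heq : i ∘L π ∘L f' = f' := hd.unique hf.hasFDerivAt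
  have hinj : Function.Injective (π ∘L f') :=
    .of_comp (f := i) (by rwa [← ContinuousLinearMap.coe_comp, heq])
  have := FiniteDimensional.complete 𝕜 E
  exact (π.hasStrictFDerivAt.comp a hf).map_nhds_eq_of_surj
    (LinearMap.range_eq_top.2 (LinearMap.injective_iff_surjective.1 hinj))

theorem eventuallyEq_zero_of_frequently_eventuallyEq_zero [CompleteSpace F]
    [LocallyConnectedSpace E] {g : E → F} {a : E} (hg : AnalyticAt 𝕜 g a)
    (h : ∃ᶠ b in 𝓝 a, g =ᶠ[𝓝 b] 0) : g =ᶠ[𝓝 a] 0 := by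
  obtain ⟨U, ⟨hU, haU, hUc⟩, hgU⟩ := (LocallyConnectedSpace.open_connected_basis a).mem_iff.1
    hg.eventually_analyticAt
  obtain ⟨b, hgb, hbU⟩ := (h.and_eventually (hU.mem_nhds haU)).exists
  exact (AnalyticOnNhd.eqOn_zero_of_preconnected_of_eventuallyEq_zero (fun x hx => hgU hx)
    hUc.isPreconnected hbU hgb).eventuallyEq_of_mem (hU.mem_nhds haU)

end Calculus

section Charts

variable {𝕜 E M : Type*} [NontriviallyNormedField 𝕜] [NormedAddCommGroup E] [NormedSpace 𝕜 E]
  [TopologicalSpace M] [ChartedSpace E M] {k : WithTop ℕ∞} {ψ ψ' : OpenPartialHomeomorph M E}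

theorem contDiffAt_comp_symm (hψ : ψ ∈ IsManifold.maximalAtlas 𝓘(𝕜, E) k M)
    (hψ' : ψ' ∈ IsManifold.maximalAtlas 𝓘(𝕜, E) k M) {x : M} (hx : x ∈ ψ.source)
    (hx' : x ∈ ψ'.source) : ContDiffAt 𝕜 k (ψ' ∘ ψ.symm) (ψ x) :=
  (contMDiffOn_iff_contDiffOn.1 (contMDiffOn_of_mem_contDiffGroupoid
    (StructureGroupoid.compatible_of_mem_maximalAtlas hψ hψ'))).contDiffAt
      ((ψ.symm ≫ₕ ψ').open_source.mem_nhds (by simp [hx, hx']))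

theorem transHomeomorph_mem_maximalAtlas [IsManifold 𝓘(𝕜, E) k M]
    (hψ : ψ ∈ IsManifold.maximalAtlas 𝓘(𝕜, E) k M) (A : E ≃L[𝕜] E) :
    ψ.transHomeomorph A.toHomeomorph ∈ IsManifold.maximalAtlas 𝓘(𝕜, E) k M :=
  OpenPartialHomeomorph.mem_maximalAtlas_of_contMDiffOn _
    (A.contDiff.contMDiff.comp_contMDiffOn (contMDiffOn_of_mem_maximalAtlas hψ))
    ((contMDiffOn_symm_of_mem_maximalAtlas hψ).comp A.symm.contDiff.contMDiff.contMDiffOn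
      fun _ hw => hw)

end Charts

section Slices

open Set Filter

theorem nhdsWithin_eq_nhdsWithin_iff_exists_inter {X : Type*} [TopologicalSpace X] {S T : Set X}
    {x : X} : 𝓝[S] x = 𝓝[T] x ↔ ∃ W ∈ 𝓝 x, S ∩ W = T ∩ W := by
  rw [nhdsWithin_eq_iff_eventuallyEq, eventuallyEq_set, eventually_iff_exists_mem]
  refine exists_congr fun W => and_congr_right fun _ => ?_
  rw [Set.ext_iff]
  exact forall_congr' fun y => and_congr_left_iff.symm

/-- The linear map `ℂ^m → ℂ^k` that forgets the coordinates of index at least `k` and fills up with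
zeros. For `n ≤ N`, it is the projection to the first coordinates when `m = N` and `k = n`, and the
inclusion of the slice where the last coordinates vanish when `m = n` and `k = N`. -/
noncomputable def coordMap (m k : ℕ) : CSpace m →L[ℂ] CSpace k :=
  LinearMap.toContinuousLinearMap
    { toFun w := WithLp.toLp 2 fun i => if hi : (i : ℕ) < m then w ⟨i, hi⟩ else 0
      map_add' v w := by ext i; by_cases hi : (i : ℕ) < m <;> simp [hi]
      map_smul' c w := by ext i; by_cases hi : (i : ℕ) < m <;> simp [hi] }

theorem coordMap_apply {m k : ℕ} (w : CSpace m) (i : Fin k) :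
    coordMap m k w i = if hi : (i : ℕ) < m then w ⟨i, hi⟩ else 0 := rfl

variable {N n : ℕ}

theorem leftInverse_coordMap (h : n ≤ N) :
    Function.LeftInverse (coordMap N n) (coordMap n N) := fun a => by
  ext i
  simp [coordMap_apply, i.2.trans_le h]

theorem coordMap_coordMap_eq_self_iff {w : CSpace N} :
    coordMap n N (coordMap N n w) = w ↔ ∀ i : Fin N, n ≤ (i : ℕ) → w i = 0 := by
  rw [PiLp.ext_iff]
  refine forall_congr' fun i => ?_
  by_cases hi : (i : ℕ) < n
  · simp [coordMap_apply, hi]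
  · simp [coordMap_apply, hi, not_lt.1 hi, eq_comm]

/-- The splitting of `ℂ^N` into the first `n` coordinates and the remaining ones. -/
noncomputable def coordEquiv (h : n ≤ N) :
    (CSpace n × (coordMap N n).ker) ≃L[ℂ] CSpace N :=
  (ContinuousLinearEquiv.equivOfRightInverse (coordMap N n) (coordMap n N)
    (leftInverse_coordMap h)).symm

theorem coordEquiv_apply_zero (h : n ≤ N) (a : CSpace n) :
    coordEquiv h (a, 0) = coordMap n N a := by
  simp [coordEquiv]

variable {M₀ : Type*} [TopologicalSpace M₀]

/-- The slice of the chart `ψ` where the last `N - n` coordinates vanish. -/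
def slice (n : ℕ) (ψ : OpenPartialHomeomorph M₀ (CSpace N)) : Set M₀ :=
  {q ∈ ψ.source | ∀ i : Fin N, n ≤ (i : ℕ) → ψ q i = 0}

variable {ψ ψ' : OpenPartialHomeomorph M₀ (CSpace N)} {x : M₀}

theorem slice_restr {U : Set M₀} (hU : IsOpen U) : slice n (ψ.restr U) = slice n ψ ∩ U := by
  ext q
  simp only [slice, ψ.restr_source, hU.interior_eq, ψ.restr_apply, mem_ofPred_eq, mem_inter_iff]
  tauto

theorem mem_slice_iff : x ∈ slice n ψ ↔ x ∈ ψ.source ∧ coordMap n N (coordMap N n (ψ x)) = ψ x := by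
  rw [coordMap_coordMap_eq_self_iff, slice, mem_ofPred_eq]

theorem nhdsWithin_eq_nhdsWithin_slice {S : Set M₀} (hx : x ∈ ψ.source)
    (hS : ∀ q ∈ ψ.source, (q ∈ S ↔ ∀ i : Fin N, n ≤ (i : ℕ) → ψ q i = 0)) :
    𝓝[S] x = 𝓝[slice n ψ] x := by
  refine nhdsWithin_eq_iff_eventuallyEq.2 (eventuallyEq_set.2 ?_)
  filter_upwards [ψ.open_source.mem_nhds hx] with q hq using by simp [slice, hq, hS q hq]

/-- The first `n` coordinates of `ψ`, as a chart of its slice. -/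
noncomputable def sliceChart (h : n ≤ N) (ψ : OpenPartialHomeomorph M₀ (CSpace N)) :
    PartialEquiv M₀ (CSpace n) where
  toFun q := coordMap N n (ψ q)
  invFun a := ψ.symm (coordMap n N a)
  source := slice n ψ
  target := coordMap n N ⁻¹' ψ.target
  map_source' q hq := by
    rw [mem_preimage, (mem_slice_iff.1 hq).2]
    exact ψ.map_source hq.1
  map_target' a ha := mem_slice_iff.2 ⟨ψ.map_target ha, by
    rw [ψ.right_inv ha, leftInverse_coordMap h]⟩
  left_inv' q hq := by rw [(mem_slice_iff.1 hq).2, ψ.left_inv hq.1]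
  right_inv' a ha := by rw [ψ.right_inv ha, leftInverse_coordMap h]

theorem isOpen_sliceChart_target (h : n ≤ N) : IsOpen (sliceChart h ψ).target :=
  ψ.open_target.preimage (coordMap n N).continuous

theorem continuousOn_sliceChart (h : n ≤ N) : ContinuousOn (sliceChart h ψ) (slice n ψ) :=
  (coordMap N n).continuous.comp_continuousOn (ψ.continuousOn.mono fun _ hq => hq.1)

theorem continuousOn_sliceChart_symm (h : n ≤ N) :
    ContinuousOn (sliceChart h ψ).symm (sliceChart h ψ).target :=
  ψ.continuousOn_symm.comp (coordMap n N).continuous.continuousOn fun _ ha => ha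

theorem map_sliceChart_symm_nhds (h : n ≤ N) (hx : x ∈ slice n ψ) :
    map (sliceChart h ψ).symm (𝓝 (sliceChart h ψ x)) = 𝓝[slice n ψ] x := by
  refine le_antisymm (tendsto_nhdsWithin_iff.2 ⟨?_, ?_⟩) ?_
  · have := (continuousOn_sliceChart_symm h).continuousAt
      ((isOpen_sliceChart_target h).mem_nhds ((sliceChart h ψ).map_source hx))
    rwa [ContinuousAt, (sliceChart h ψ).left_inv hx] at this
  · filter_upwards [(isOpen_sliceChart_target h).mem_nhds ((sliceChart h ψ).map_source hx)]
      with a ha using (sliceChart h ψ).map_target ha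
  · calc 𝓝[slice n ψ] x = map ((sliceChart h ψ).symm ∘ sliceChart h ψ) (𝓝[slice n ψ] x) := by
          refine (map_congr ?_).trans map_id |>.symm
          filter_upwards [self_mem_nhdsWithin] with q hq using (sliceChart h ψ).left_inv hq
      _ ≤ map (sliceChart h ψ).symm (𝓝 (sliceChart h ψ x)) := by
          rw [← map_map]
          exact map_mono (continuousOn_sliceChart h x hx)

theorem slice_mem_nhdsWithin_iff (h : n ≤ N) (hx : x ∈ slice n ψ) (hx' : x ∈ ψ'.source) :
    slice n ψ' ∈ 𝓝[slice n ψ] x ↔ ∀ᶠ a in 𝓝 (sliceChart h ψ x),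
      coordMap n N (coordMap N n (ψ' ((sliceChart h ψ).symm a))) =
        ψ' ((sliceChart h ψ).symm a) := by
  have hsource : ∀ᶠ y in 𝓝[slice n ψ] x, y ∈ ψ'.source :=
    nhdsWithin_le_nhds (ψ'.open_source.mem_nhds hx')
  rw [← map_sliceChart_symm_nhds h hx, eventually_map] at hsource
  rw [← map_sliceChart_symm_nhds h hx, mem_map]
  exact eventually_congr (hsource.mono fun a ha => by rw [mem_slice_iff, and_iff_right ha])

variable [ChartedSpace (CSpace N) M₀]

theorem contDiffAt_comp_sliceChart_symm (h : n ≤ N)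
    (hψ : ψ ∈ IsManifold.maximalAtlas 𝓘(ℂ, CSpace N) ω M₀)
    (hψ' : ψ' ∈ IsManifold.maximalAtlas 𝓘(ℂ, CSpace N) ω M₀) (hx : x ∈ slice n ψ)
    (hx' : x ∈ ψ'.source) : ContDiffAt ℂ ω (ψ' ∘ (sliceChart h ψ).symm) (sliceChart h ψ x) := by
  have hψx : coordMap n N (sliceChart h ψ x) = ψ x := (mem_slice_iff.1 hx).2
  have htransition := contDiffAt_comp_symm hψ hψ' hx.1 hx'
  rw [← hψx] at htransition
  exact htransition.comp _ (coordMap n N).contDiff.contDiffAt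

theorem slice_mem_nhdsWithin_of_frequently (h : n ≤ N)
    (hψ : ψ ∈ IsManifold.maximalAtlas 𝓘(ℂ, CSpace N) ω M₀)
    (hψ' : ψ' ∈ IsManifold.maximalAtlas 𝓘(ℂ, CSpace N) ω M₀)
    (hx : x ∈ slice n ψ) (hx' : x ∈ ψ'.source)
    (hfreq : ∃ᶠ y in 𝓝[slice n ψ] x, slice n ψ' ∈ 𝓝[slice n ψ] y) :
    slice n ψ' ∈ 𝓝[slice n ψ] x := by
  let f := ψ' ∘ (sliceChart h ψ).symm
  let defect (a : CSpace n) : CSpace N := coordMap n N (coordMap N n (f a)) - f a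
  have hdefect : ∀ y ∈ slice n ψ, y ∈ ψ'.source →
      (slice n ψ' ∈ 𝓝[slice n ψ] y ↔ defect =ᶠ[𝓝 (sliceChart h ψ y)] 0) := fun y hy hy' => by
    rw [slice_mem_nhdsWithin_iff h hy hy']
    exact eventually_congr (.of_forall fun a => sub_eq_zero.symm)
  have hf : ContDiffAt ℂ ω f (sliceChart h ψ x) := contDiffAt_comp_sliceChart_symm h hψ hψ' hx hx'
  have hanalytic : AnalyticAt ℂ defect (sliceChart h ψ x) :=
    (((coordMap n N ∘L coordMap N n).contDiff.contDiffAt.comp _ hf).sub hf).analyticAt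
  refine (hdefect x hx hx').2 (eventuallyEq_zero_of_frequently_eventuallyEq_zero hanalytic ?_)
  have htendsto : Tendsto (sliceChart h ψ) (𝓝[slice n ψ] x) (𝓝 (sliceChart h ψ x)) :=
    continuousOn_sliceChart h x hx
  have hnear : ∀ᶠ y in 𝓝[slice n ψ] x, y ∈ slice n ψ ∧ y ∈ ψ'.source :=
    inter_mem self_mem_nhdsWithin (nhdsWithin_le_nhds (ψ'.open_source.mem_nhds hx'))
  exact htendsto.frequently ((hfreq.and_eventually hnear).mono fun y ⟨hy, hyψ, hyψ'⟩ =>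
    (hdefect y hyψ hyψ').1 hy)

theorem nhdsWithin_slice_eq_of_mem (h : n ≤ N)
    (hψ : ψ ∈ IsManifold.maximalAtlas 𝓘(ℂ, CSpace N) ω M₀)
    (hψ' : ψ' ∈ IsManifold.maximalAtlas 𝓘(ℂ, CSpace N) ω M₀)
    (hx : x ∈ slice n ψ) (hx' : slice n ψ' ∈ 𝓝[slice n ψ] x) :
    𝓝[slice n ψ] x = 𝓝[slice n ψ'] x := by
  have hxψ' : x ∈ slice n ψ' := mem_of_mem_nhdsWithin hx hx'
  have hslice : ∀ᶠ a in 𝓝 (sliceChart h ψ x), (sliceChart h ψ).symm a ∈ slice n ψ' := by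
    rwa [← map_sliceChart_symm_nhds h hx] at hx'
  let f := ψ' ∘ (sliceChart h ψ).symm
  have hfx : f (sliceChart h ψ x) = ψ' x := congrArg ψ' ((sliceChart h ψ).left_inv hx)
  have hf : ContDiffAt ℂ ω f (sliceChart h ψ x) :=
    contDiffAt_comp_sliceChart_symm h hψ hψ' hx hxψ'.1
  have hinj : Function.Injective (fderiv ℂ f (sliceChart h ψ x)) := by
    refine injective_of_hasFDerivAt_of_eventually_leftInverse
      (g := coordMap N n ∘ ψ ∘ ψ'.symm) (hf.differentiableAt (by simp)).hasFDerivAt ?_ ?_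
    · rw [hfx]
      exact (coordMap N n).differentiableAt.comp _
        ((contDiffAt_comp_symm hψ' hψ hxψ'.1 hx.1).differentiableAt (by simp))
    · filter_upwards [hslice, (isOpen_sliceChart_target h).mem_nhds
        ((sliceChart h ψ).map_source hx)] with a ha hat
      simp only [f, Function.comp_apply, ψ'.left_inv ha.1]
      exact (sliceChart h ψ).right_inv hat
  -- The two slices have the same dimension, so the inverse function theorem applies.
  have hmap : map (sliceChart h ψ' ∘ (sliceChart h ψ).symm) (𝓝 (sliceChart h ψ x)) =
      𝓝 (sliceChart h ψ' x) := by
    have := map_nhds_comp_eq_of_hasStrictFDerivAt_of_injective (hf.hasStrictFDerivAt (by simp)) hinj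
      ((slice_mem_nhdsWithin_iff h hx hxψ'.1).1 hx')
    rwa [hfx] at this
  rw [← map_sliceChart_symm_nhds h hxψ', ← hmap, map_map, ← map_sliceChart_symm_nhds h hx]
  exact map_congr (hslice.mono fun a ha => ((sliceChart h ψ').left_inv ha).symm)

theorem isComplexSubmanifold_slice (hψ : ψ ∈ IsManifold.maximalAtlas 𝓘(ℂ, CSpace N) ω M₀) :
    IsComplexSubmanifold N n (slice n ψ) :=
  fun _ hp => ⟨ψ, hψ, hp.1, fun _ hq => and_iff_right hq⟩

end Slices

namespace GermSpace

open Set Filter TopologicalSpace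

variable {N n : ℕ} {M₀ : Type*} [TopologicalSpace M₀] [ChartedSpace (CSpace N) M₀]
  {S : Set M₀} {hS : IsComplexSubmanifold N n S} {s t : GermSpace N n M₀}

/-- The filter of neighbourhoods of `x` in `S`, for the germ `[S]_x`. It determines the germ. -/
def nhdsAlong (s : GermSpace N n M₀) : Filter M₀ :=
  Quotient.lift (fun S : SubmanifoldThrough N n s.1 => 𝓝[S.1] s.1)
    (fun _ _ hST => nhdsWithin_eq_nhdsWithin_iff_exists_inter.2 hST) s.2

theorem exists_eq_germ (s : GermSpace N n M₀) :
    ∃ (S : Set M₀) (hS : IsComplexSubmanifold N n S) (x : M₀) (hx : x ∈ S), s = germ S hS x hx := by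
  obtain ⟨x, S⟩ := s
  induction S using Quotient.inductionOn with
  | h S => exact ⟨S.1, S.2.1, x, S.2.2, rfl⟩

theorem ext_nhdsAlong (hproj : s.proj = t.proj) (hst : s.nhdsAlong = t.nhdsAlong) : s = t := by
  obtain ⟨S, hS, x, hx, rfl⟩ := s.exists_eq_germ
  obtain ⟨T, hT, y, hy, rfl⟩ := t.exists_eq_germ
  obtain rfl : x = y := hproj
  exact Sigma.ext rfl (heq_of_eq (Quotient.sound (nhdsWithin_eq_nhdsWithin_iff_exists_inter.1 hst)))

theorem mem_germsOf_iff : s ∈ germsOf S hS ↔ s.nhdsAlong = 𝓝[S] s.proj := by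
  constructor
  · rintro ⟨x, hx, rfl⟩
    rfl
  · intro hs
    have hmem : s.proj ∈ S := by
      obtain ⟨T, hT, x, hx, rfl⟩ := s.exists_eq_germ
      have hST : 𝓝[T] x = 𝓝[S] x := hs
      exact mem_of_mem_nhdsWithin hx (hST ▸ self_mem_nhdsWithin)
    exact ⟨s.proj, hmem, ext_nhdsAlong rfl hs⟩

theorem bijOn_proj (hS : IsComplexSubmanifold N n S) : BijOn proj (germsOf S hS) S := by
  refine ⟨?_, fun s hs t ht hst => ?_, fun x hx => ⟨_, ⟨x, hx, rfl⟩, rfl⟩⟩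
  · rintro _ ⟨x, hx, rfl⟩
    exact hx
  · refine ext_nhdsAlong hst ?_
    rw [mem_germsOf_iff.1 hs, mem_germsOf_iff.1 ht, hst]

theorem isOpen_germsOf (hS : IsComplexSubmanifold N n S) : IsOpen (germsOf S hS) :=
  isOpen_generateFrom_of_mem ⟨S, hS, rfl⟩

section Sheet

variable {ψ ψ' : OpenPartialHomeomorph M₀ (CSpace N)}
  (hψ : ψ ∈ IsManifold.maximalAtlas 𝓘(ℂ, CSpace N) ω M₀)
  (hψ' : ψ' ∈ IsManifold.maximalAtlas 𝓘(ℂ, CSpace N) ω M₀)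

/-- The basic open set of germs of the slice of the chart `ψ`. -/
abbrev sheet : Set (GermSpace N n M₀) := germsOf (slice n ψ) (isComplexSubmanifold_slice hψ)

theorem exists_mem_sheet (s : GermSpace N n M₀) :
    ∃ (ψ : OpenPartialHomeomorph M₀ (CSpace N))
      (hψ : ψ ∈ IsManifold.maximalAtlas 𝓘(ℂ, CSpace N) ω M₀), s ∈ sheet hψ := by
  obtain ⟨S, hS, x, hx, rfl⟩ := s.exists_eq_germ
  obtain ⟨ψ, hψ, hxψ, hSψ⟩ := hS x hx
  exact ⟨ψ, hψ, mem_germsOf_iff.2 (nhdsWithin_eq_nhdsWithin_slice hxψ hSψ)⟩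

theorem continuous_proj : Continuous (proj : GermSpace N n M₀ → M₀) := by
  refine continuous_def.2 fun U hU => isOpen_iff_mem_nhds.2 fun s hs => ?_
  obtain ⟨ψ, hψ, hsψ⟩ := s.exists_mem_sheet
  have hψU := restr_mem_maximalAtlas (contDiffGroupoid ω 𝓘(ℂ, CSpace N)) hψ hU
  have hsub : sheet hψU ⊆ (proj ⁻¹' U : Set (GermSpace N n M₀)) := fun t ht =>
    (slice_restr hU ▸ (bijOn_proj _).mapsTo ht : t.proj ∈ slice n ψ ∩ U).2
  refine mem_of_superset ((isOpen_germsOf _).mem_nhds (mem_germsOf_iff.2 ?_)) hsub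
  rw [mem_germsOf_iff.1 hsψ, slice_restr hU, nhdsWithin_inter_of_mem'
    (mem_nhdsWithin_of_mem_nhds (hU.mem_nhds hs))]

theorem nhds_eq (hs : s ∈ germsOf S hS) : 𝓝 s = comap proj (𝓝 s.proj) ⊓ 𝓟 (germsOf S hS) := by
  refine le_antisymm (le_inf continuous_proj.continuousAt.le_comap
    (le_principal_iff.2 ((isOpen_germsOf hS).mem_nhds hs))) ?_
  rw [nhds_generateFrom]
  refine le_iInf₂ ?_
  rintro _ ⟨hsT, T, hT, rfl⟩
  have hST : S =ᶠ[𝓝 s.proj] T := by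
    rw [← nhdsWithin_eq_iff_eventuallyEq, ← mem_germsOf_iff.1 hs, mem_germsOf_iff.1 hsT]
  rw [le_principal_iff, mem_inf_principal]
  filter_upwards [preimage_mem_comap (eventually_eventually_nhds.2 hST)] with t ht htS
  exact mem_germsOf_iff.2 ((mem_germsOf_iff.1 htS).trans (nhdsWithin_eq_iff_eventuallyEq.2 ht))

theorem continuousWithinAt_of_proj {Z : Type*} [TopologicalSpace Z] {A : Set Z} {z : Z}
    {g : Z → GermSpace N n M₀} (hz : g z ∈ germsOf S hS)
    (hproj : ContinuousWithinAt (proj ∘ g) A z) (hg : ∀ᶠ y in 𝓝[A] z, g y ∈ germsOf S hS) :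
    ContinuousWithinAt g A z := by
  rw [ContinuousWithinAt, nhds_eq hz, tendsto_inf, tendsto_comap_iff, tendsto_principal]
  exact ⟨hproj, hg⟩

theorem secondCountableTopology_germsOf [SecondCountableTopology M₀]
    (hS : IsComplexSubmanifold N n S) : SecondCountableTopology (germsOf S hS) := by
  have : Topology.IsInducing fun s : germsOf S hS => (s : GermSpace N n M₀).proj :=
    Topology.isInducing_iff_nhds.2 fun s => by
      rw [nhds_subtype_eq_comap, nhds_eq s.2, comap_inf, comap_comap, comap_principal,
        Subtype.coe_preimage_self, principal_univ, inf_top_eq]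
      rfl
  exact this.secondCountableTopology

theorem mem_sheet_of_mem_closure (h : n ≤ N) (hs : s ∈ closure (sheet hψ))
    (hsψ : s.proj ∈ ψ.source) : s ∈ sheet hψ := by
  obtain ⟨ψ', hψ', hsψ'⟩ := s.exists_mem_sheet
  have hnear : ∀ᶠ t in 𝓝 s, t ∈ sheet hψ' := (isOpen_germsOf _).mem_nhds hsψ'
  have hproj : Tendsto proj (𝓝 s) (𝓝[slice n ψ'] s.proj) :=
    tendsto_nhdsWithin_iff.2 ⟨continuous_proj.continuousAt,
      hnear.mono fun t ht => (bijOn_proj _).mapsTo ht⟩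
  have hfreq : ∃ᶠ y in 𝓝[slice n ψ'] s.proj, slice n ψ ∈ 𝓝[slice n ψ'] y := by
    refine hproj.frequently (((mem_closure_iff_frequently.1 hs).and_eventually hnear).mono ?_)
    rintro t ⟨ht, ht'⟩
    rw [← mem_germsOf_iff.1 ht', mem_germsOf_iff.1 ht]
    exact self_mem_nhdsWithin
  have hs' : s.proj ∈ slice n ψ' := (bijOn_proj _).mapsTo hsψ'
  rw [mem_germsOf_iff, mem_germsOf_iff.1 hsψ']
  exact nhdsWithin_slice_eq_of_mem h hψ' hψ hs'
    (slice_mem_nhdsWithin_of_frequently h hψ' hψ hs' hsψ hfreq)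

theorem t2Space [T2Space M₀] (h : n ≤ N) : T2Space (GermSpace N n M₀) := by
  refine ⟨fun s t hst => ?_⟩
  by_cases hproj : s.proj = t.proj
  · obtain ⟨ψ, hψ, hs⟩ := s.exists_mem_sheet
    have ht : t ∉ closure (sheet hψ) := fun ht => by
      have hsψ : s.proj ∈ ψ.source := ((bijOn_proj _).mapsTo hs).1
      exact hst ((bijOn_proj _).injOn hs (mem_sheet_of_mem_closure hψ h ht (hproj ▸ hsψ)) hproj)
    exact ⟨_, _, isOpen_germsOf _, isClosed_closure.isOpen_compl, hs, ht,
      disjoint_compl_right.mono_left subset_closure⟩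
  · exact separated_by_continuous continuous_proj hproj

/-- The chart of the germ space that sends `[S]_x`, with `S` the slice of `ψ`, to the first `n`
coordinates of `ψ x`. -/
noncomputable def germChart [Nonempty (GermSpace N n M₀)] (h : n ≤ N) :
    OpenPartialHomeomorph (GermSpace N n M₀) (CSpace n) where
  toPartialEquiv := ((bijOn_proj (isComplexSubmanifold_slice hψ)).toPartialEquiv _ _ _).trans'
    (sliceChart h ψ) rfl
  open_source := isOpen_germsOf _
  open_target := isOpen_sliceChart_target h
  continuousOn_toFun := (continuousOn_sliceChart h).comp continuous_proj.continuousOn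
    (bijOn_proj _).mapsTo
  continuousOn_invFun := fun a ha => by
    have hmaps : ∀ b ∈ (sliceChart h ψ).target,
        Function.invFunOn proj (sheet hψ) ((sliceChart h ψ).symm b) ∈ sheet hψ := fun b hb =>
      (bijOn_proj _).surjOn.mapsTo_invFunOn ((sliceChart h ψ).map_target hb)
    refine continuousWithinAt_of_proj (hmaps a ha) ?_ (eventually_mem_nhdsWithin.mono hmaps)
    refine (continuousOn_sliceChart_symm h a ha).congr (fun b hb => ?_) ?_
    · exact (bijOn_proj _).surjOn.rightInvOn_invFunOn ((sliceChart h ψ).map_target hb)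
    · exact (bijOn_proj _).surjOn.rightInvOn_invFunOn ((sliceChart h ψ).map_target ha)

theorem proj_germChart_symm [Nonempty (GermSpace N n M₀)] (h : n ≤ N) {a : CSpace n}
    (ha : a ∈ (germChart hψ h).target) :
    ((germChart hψ h).symm a).proj = (sliceChart h ψ).symm a :=
  (bijOn_proj _).surjOn.rightInvOn_invFunOn ((sliceChart h ψ).map_target ha)

end Sheet

variable (M₀) in
/-- The charts `germChart` make the germ space an `n`-dimensional manifold. -/
noncomputable abbrev chartedSpace (h : n ≤ N) : ChartedSpace (CSpace n) (GermSpace N n M₀) where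
  atlas := {e | ∃ (_ : Nonempty (GermSpace N n M₀)) (ψ : OpenPartialHomeomorph M₀ (CSpace N))
    (hψ : ψ ∈ IsManifold.maximalAtlas 𝓘(ℂ, CSpace N) ω M₀), e = germChart hψ h}
  chartAt s := haveI : Nonempty (GermSpace N n M₀) := ⟨s⟩
    germChart s.exists_mem_sheet.choose_spec.choose h
  mem_chart_source s := s.exists_mem_sheet.choose_spec.choose_spec
  chart_mem_atlas s := ⟨⟨s⟩, _, _, rfl⟩

theorem isManifold (h : n ≤ N) :
    letI := chartedSpace M₀ h
    IsManifold 𝓘(ℂ, CSpace n) ω (GermSpace N n M₀) := by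
  let := chartedSpace M₀ h
  refine isManifold_of_contDiffOn _ _ _ ?_
  rintro _ _ ⟨_, ψ, hψ, rfl⟩ ⟨_, ψ', hψ', rfl⟩
  suffices ContDiffOn ℂ ω (germChart hψ' h ∘ (germChart hψ h).symm)
      ((germChart hψ h).symm ≫ₕ germChart hψ' h).source by simpa
  rintro a ⟨ha, ha'⟩
  have hproj := proj_germChart_symm hψ h ha
  have haψ' : (sliceChart h ψ).symm a ∈ slice n ψ' := hproj ▸ (bijOn_proj _).mapsTo ha'
  have hsmooth := contDiffAt_comp_sliceChart_symm h hψ hψ' ((sliceChart h ψ).map_target ha) haψ'.1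
  rw [(sliceChart h ψ).right_inv ha] at hsmooth
  refine (((coordMap N n).contDiff.contDiffAt.comp a hsmooth).congr_of_eventuallyEq
    ?_).contDiffWithinAt
  filter_upwards [(germChart hψ h).open_target.mem_nhds ha] with b hb using
    congrArg (sliceChart h ψ') (proj_germChart_symm hψ h hb)

theorem isOpen_connectedComponent (h : n ≤ N) (s : GermSpace N n M₀) :
    IsOpen (connectedComponent s) :=
  letI := chartedSpace M₀ h
  haveI := ChartedSpace.locallyConnectedSpace (CSpace n) (GermSpace N n M₀)
  _root_.isOpen_connectedComponent

theorem secondCountableTopology_connectedComponent [SecondCountableTopology M₀]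
    (h : n ≤ N) (s : GermSpace N n M₀) : SecondCountableTopology (connectedComponent s) := by
  let := chartedSpace M₀ h
  have := ChartedSpace.locallyConnectedSpace (CSpace n) (GermSpace N n M₀)
  refine secondCountableTopology_connectedComponent_of_continuous continuous_proj (fun t => ?_) s
  obtain ⟨ψ, hψ, ht⟩ := t.exists_mem_sheet
  have htψ : t.proj ∈ ψ.source := ((bijOn_proj _).mapsTo ht).1
  refine ⟨ψ.source, ψ.open_source, htψ, ?_⟩
  have hsub : connectedComponentIn (proj ⁻¹' ψ.source) t ⊆ sheet (n := n) hψ :=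
    isPreconnected_connectedComponentIn.subset_of_closure_inter_subset (isOpen_germsOf _)
      ⟨t, mem_connectedComponentIn htψ, ht⟩ fun u ⟨hu, huC⟩ =>
        mem_sheet_of_mem_closure hψ h hu (connectedComponentIn_subset (proj ⁻¹' ψ.source) t huC)
  have := secondCountableTopology_germsOf (isComplexSubmanifold_slice (n := n) hψ)
  exact secondCountableTopology_mono hsub

theorem isImmersion_proj (h : n ≤ N) (O : Opens (GermSpace N n M₀)) :
    letI := chartedSpace M₀ h
    Manifold.IsImmersion 𝓘(ℂ, CSpace n) 𝓘(ℂ, CSpace N) ω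
      fun s : O => (s : GermSpace N n M₀).proj := by
  let := chartedSpace M₀ h
  have := isManifold (M₀ := M₀) h
  refine Manifold.IsImmersionOfComplement.isImmersion (F := (coordMap N n).ker) fun s => ?_
  obtain ⟨_, ψ, hψ, hchart⟩ := chart_mem_atlas (CSpace n) (s : GermSpace N n M₀)
  have hs : (s : GermSpace N n M₀) ∈ sheet hψ := by
    have := mem_chart_source (CSpace n) (s : GermSpace N n M₀)
    rwa [hchart] at this
  refine Manifold.IsImmersionAtOfComplement.mk_of_continuousAt
    (continuous_proj.comp continuous_subtype_val).continuousAt (coordEquiv h) (chartAt _ s) ψ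
    (mem_chart_source _ s) ((bijOn_proj _).mapsTo hs).1 (IsManifold.chart_mem_maximalAtlas s)
    hψ fun a ha => ?_
  have hOchart : a ∈ ((chartAt (CSpace n) (s : GermSpace N n M₀)).subtypeRestr ⟨s⟩).target := by
    simpa [Opens.chartAt_eq] using ha
  have ha' : a ∈ (germChart hψ h).target := by
    rw [← hchart]
    exact OpenPartialHomeomorph.subtypeRestr_target_subset _ ⟨s⟩ hOchart
  have hsymm : (((chartAt (CSpace n) s).symm a : O) : GermSpace N n M₀) =
      (germChart hψ h).symm a := by
    rw [← hchart, Opens.chartAt_eq]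
    exact OpenPartialHomeomorph.subtypeRestr_symm_apply _ ⟨s⟩ hOchart
  have hψa : ψ ((sliceChart h ψ).symm a) = coordMap n N a := ψ.right_inv ha'
  simp [hsymm, proj_germChart_symm hψ h ha', hψa, coordEquiv_apply_zero]

theorem nonempty_leafStructure [T2Space M₀] [SecondCountableTopology M₀] (h : n ≤ N)
    (s : GermSpace N n M₀) :
    Nonempty (LeafStructure N n (proj : GermSpace N n M₀ → M₀) (connectedComponent s)) := by
  let := chartedSpace M₀ h
  have := isManifold (M₀ := M₀) h
  have := t2Space (M₀ := M₀) h
  let O : Opens (GermSpace N n M₀) := ⟨connectedComponent s, isOpen_connectedComponent h s⟩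
  exact ⟨@LeafStructure.mk _ _ _ _ _ _ _ _ _ (inferInstanceAs (T2Space O))
    (secondCountableTopology_connectedComponent h s) (inferInstanceAs (ChartedSpace (CSpace n) O))
    (inferInstanceAs (IsManifold 𝓘(ℂ, CSpace n) ω O)) (isImmersion_proj h O)⟩

end GermSpace

section Immersion

open Filter Manifold

variable {N n : ℕ} {M₀ : Type*} [TopologicalSpace M₀] [ChartedSpace (CSpace N) M₀]
  [IsManifold 𝓘(ℂ, CSpace N) ω M₀] {M : Type*} [TopologicalSpace M] [ChartedSpace (CSpace n) M]
  {φ : M → M₀}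

theorem exists_continuousLinearEquiv_apply_coordMap (h : n ≤ N) {F : Type*} [NormedAddCommGroup F]
    [NormedSpace ℂ F] (A : (CSpace n × F) ≃L[ℂ] CSpace N) :
    ∃ E : CSpace N ≃L[ℂ] CSpace N, ∀ a, E (A (a, 0)) = coordMap n N a := by
  have : FiniteDimensional ℂ (CSpace n × F) := A.symm.toLinearEquiv.finiteDimensional
  have : FiniteDimensional ℂ F :=
    Module.Finite.of_surjective (LinearMap.snd ℂ (CSpace n) F) LinearMap.snd_surjective
  have hdim : Module.finrank ℂ F = Module.finrank ℂ (coordMap N n).ker := by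
    have := (A.trans (coordEquiv h).symm).toLinearEquiv.finrank_eq
    simpa only [Module.finrank_prod, add_right_inj] using this
  let B : F ≃L[ℂ] (coordMap N n).ker := .ofFinrankEq hdim
  refine ⟨A.symm.trans (((ContinuousLinearEquiv.refl ℂ _).prodCongr B).trans (coordEquiv h)),
    fun a => ?_⟩
  simp [coordEquiv_apply_zero]

theorem exists_eventually_map_nhds_eq_nhdsWithin_slice (h : n ≤ N)
    (hφ : IsImmersion 𝓘(ℂ, CSpace n) 𝓘(ℂ, CSpace N) ω φ) (p : M) :
    ∃ ψ ∈ IsManifold.maximalAtlas 𝓘(ℂ, CSpace N) ω M₀, φ p ∈ slice n ψ ∧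
      ∀ᶠ q in 𝓝 p, map φ (𝓝 q) = 𝓝[slice n ψ] (φ q) := by
  have hp := hφ.isImmersionOfComplement_complement p
  let d := hp.domChart
  let c := hp.codChart
  obtain ⟨E, hE⟩ := exists_continuousLinearEquiv_apply_coordMap h hp.equiv
  let ψ := c.transHomeomorph E.toHomeomorph
  have hψφ : ∀ q ∈ d.source, ψ (φ q) = coordMap n N (d q) := fun q hq => by
    have hdt : d q ∈ (d.extend 𝓘(ℂ, CSpace n)).target := by simpa using d.map_source hq
    have hcφ := hp.writtenInCharts hdt
    have hdq : d.symm (d q) = q := d.left_inv hq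
    rw [← hE]
    exact congrArg E (by simpa [d, hdq] using hcφ)
  have hslice : ∀ q ∈ d.source, φ q ∈ slice n ψ := fun q hq => mem_slice_iff.2
    ⟨hp.source_subset_preimage_source hq, by rw [hψφ q hq, leftInverse_coordMap h]⟩
  have hchart : ∀ q ∈ d.source, sliceChart h ψ (φ q) = d q := fun q hq =>
    (congrArg (coordMap N n) (hψφ q hq)).trans (leftInverse_coordMap h _)
  refine ⟨ψ, transHomeomorph_mem_maximalAtlas hp.codChart_mem_maximalAtlas E,
    hslice p hp.mem_domChart_source, ?_⟩
  filter_upwards [d.open_source.mem_nhds hp.mem_domChart_source] with q hq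
  rw [← map_sliceChart_symm_nhds h (hslice q hq), hchart q hq, ← d.map_nhds_eq hq, map_map]
  refine map_congr ?_
  filter_upwards [d.open_source.mem_nhds hq] with r hr
  rw [Function.comp_apply, ← hchart r hr, (sliceChart h ψ).left_inv (hslice r hr)]

namespace GermSpace

theorem nhdsAlong_lift (h : n ≤ N) (hφ : IsImmersion 𝓘(ℂ, CSpace n) 𝓘(ℂ, CSpace N) ω φ)
    {ρ : M → GermSpace N n M₀} (hρ : Continuous ρ) (hφρ : φ = proj ∘ ρ) (p : M) :
    (ρ p).nhdsAlong = map φ (𝓝 p) := by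
  obtain ⟨ψ, hψ, hpψ, hmap⟩ := exists_eventually_map_nhds_eq_nhdsWithin_slice h hφ p
  obtain ⟨ψ', hψ', hpψ'⟩ := (ρ p).exists_mem_sheet
  have hproj : (ρ p).proj = φ p := (congrFun hφρ p).symm
  have hslice : slice n ψ' ∈ map φ (𝓝 p) := by
    have hsheet : ∀ᶠ q in 𝓝 p, ρ q ∈ sheet hψ' := hρ.continuousAt ((isOpen_germsOf _).mem_nhds hpψ')
    rw [hφρ]
    exact hsheet.mono fun q hq => (bijOn_proj _).mapsTo hq
  rw [hmap.self_of_nhds] at hslice ⊢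
  rw [mem_germsOf_iff.1 hpψ', hproj, nhdsWithin_slice_eq_of_mem h hψ hψ' hpψ hslice]

theorem existsUnique_lift (h : n ≤ N) (hφ : IsImmersion 𝓘(ℂ, CSpace n) 𝓘(ℂ, CSpace N) ω φ) :
    ∃! ρ : M → GermSpace N n M₀, Continuous ρ ∧ φ = proj ∘ ρ := by
  choose ψ hψ hpψ hmap using exists_eventually_map_nhds_eq_nhdsWithin_slice h hφ
  let ρ (p : M) : GermSpace N n M₀ :=
    germ (slice n (ψ p)) (isComplexSubmanifold_slice (hψ p)) (φ p) (hpψ p)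
  have hρ (p : M) : (ρ p).nhdsAlong = map φ (𝓝 p) := (hmap p).self_of_nhds.symm
  refine ⟨ρ, ⟨continuous_iff_continuousAt.2 fun p => ?_, rfl⟩, fun ρ' ⟨hρ', hφρ'⟩ => funext fun p =>
    ext_nhdsAlong (congrFun hφρ' p).symm ((nhdsAlong_lift h hφ hρ' hφρ' p).trans (hρ p).symm)⟩
  have hsheet : ∀ᶠ q in 𝓝 p, ρ q ∈ sheet (hψ p) :=
    (hmap p).mono fun q hq => mem_germsOf_iff.2 ((hρ q).trans hq)
  rw [← continuousWithinAt_univ]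
  exact continuousWithinAt_of_proj hsheet.self_of_nhds
    hφ.contMDiff.continuous.continuousWithinAt (nhdsWithin_univ p ▸ hsheet)

theorem isUniversalLeafSpace.{t, a} {M₀ : Type a} [TopologicalSpace M₀] [T2Space M₀]
    [SecondCountableTopology M₀] [ChartedSpace (CSpace N) M₀]
    [IsManifold 𝓘(ℂ, CSpace N) ω M₀] (h : n ≤ N) :
    IsUniversalLeafSpace.{t, a, a} N n (proj : GermSpace N n M₀ → M₀) where
  continuous := continuous_proj
  leaf := nonempty_leafStructure h
  lift _ _ _ _ _ _ _ hφ := existsUnique_lift h hφ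

end GermSpace

end Immersion

section Uniqueness

open Set

universe t a

variable {N n : ℕ} {M₀ : Type a} [TopologicalSpace M₀] [ChartedSpace (CSpace N) M₀]

theorem LeafStructure.contMDiff_of_continuous {X Y : Type*} [TopologicalSpace X]
    [TopologicalSpace Y] {τ : X → M₀} {τ' : Y → M₀} {L : Set X} {L' : Set Y}
    (A : LeafStructure N n τ L) (B : LeafStructure N n τ' L') {f : L → L'} (hf : Continuous f)
    (hfτ : ∀ p, τ' (f p) = τ p) :
    letI := A.charted
    letI := B.charted
    ContMDiff 𝓘(ℂ, CSpace n) 𝓘(ℂ, CSpace n) ω f := by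
  let := A.charted
  let := B.charted
  refine (ContMDiff.iff_comp_isImmersion B.isImmersion).2 ⟨hf, ?_⟩
  exact A.isImmersion.contMDiff.congr hfτ

namespace IsUniversalLeafSpace

variable {X Y : Type t} [TopologicalSpace X] [TopologicalSpace Y] {τ : X → M₀} {τ' : Y → M₀}

theorem existsUnique_lift_leaf (hX : IsUniversalLeafSpace.{t, a, t} N n τ)
    (hY : IsUniversalLeafSpace.{t, a, t} N n τ') (s : X) :
    ∃! ρ : connectedComponent s → Y, Continuous ρ ∧ τ ∘ (↑) = τ' ∘ ρ := by
  obtain ⟨A⟩ := hX.leaf s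
  have := A.t2
  have := A.secondCountable
  let := A.charted
  have := A.isManifold
  exact hY.lift (connectedComponent s) _ A.isImmersion

theorem exists_equiv_leafwiseContinuous (hX : IsUniversalLeafSpace.{t, a, t} N n τ)
    (hY : IsUniversalLeafSpace.{t, a, t} N n τ') :
    ∃ e : X ≃ Y, LeafwiseContinuous e ∧ LeafwiseContinuous e.symm ∧ τ = τ' ∘ e := by
  have eq_id : ∀ {Z : Type t} [TopologicalSpace Z] {ζ : Z → M₀} {f : Z → Z},
      IsUniversalLeafSpace.{t, a, t} N n ζ → LeafwiseContinuous f → ζ = ζ ∘ f → f = id :=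
    fun hZ hf hfζ => (existsUnique_leafwiseContinuous_lift (hZ.existsUnique_lift_leaf hZ)).unique
      ⟨hf, hfζ⟩ ⟨fun _ => continuousOn_id, rfl⟩
  obtain ⟨e, ⟨he, heτ⟩, -⟩ :=
    existsUnique_leafwiseContinuous_lift (hX.existsUnique_lift_leaf hY)
  obtain ⟨g, ⟨hg, hgτ⟩, -⟩ :=
    existsUnique_leafwiseContinuous_lift (hY.existsUnique_lift_leaf hX)
  have hge : g ∘ e = id := eq_id hX (hg.comp he) (by rw [← Function.comp_assoc, ← hgτ, ← heτ])
  have heg : e ∘ g = id := eq_id hY (he.comp hg) (by rw [← Function.comp_assoc, ← heτ, ← hgτ])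
  exact ⟨⟨e, g, congrFun hge, congrFun heg⟩, he, hg, heτ⟩

theorem exists_isLeafEquivalence (hX : IsUniversalLeafSpace.{t, a, t} N n τ)
    (hY : IsUniversalLeafSpace.{t, a, t} N n τ') (hXo : ∀ s : X, IsOpen (connectedComponent s)) :
    ∃ e : X → Y, IsLeafEquivalence N n τ τ' e ∧
      ((∀ y : Y, IsOpen (connectedComponent y)) → IsHomeomorph e) := by
  obtain ⟨e, he, hsymm, heτ⟩ := hX.exists_equiv_leafwiseContinuous hY
  have hcont := he.continuous hXo
  refine ⟨e, ⟨hcont, e.bijective, heτ, fun s A B => ?_⟩, fun hYo =>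
    (Homeomorph.mk e hcont (hsymm.continuous hYo)).isHomeomorph⟩
  have hmaps := he.mapsTo s
  have hmaps_symm : MapsTo e.symm (connectedComponent (e s)) (connectedComponent s) := by
    simpa only [e.symm_apply_apply] using hsymm.mapsTo (e s)
  let := A.charted
  let := B.charted
  exact ⟨⟨⟨hmaps.restrict, hmaps_symm.restrict, fun p => Subtype.ext (e.symm_apply_apply p),
      fun p => Subtype.ext (e.apply_symm_apply p)⟩,
    A.contMDiff_of_continuous B ((he s).mapsToRestrict hmaps) fun p => (congrFun heτ p).symm,
    B.contMDiff_of_continuous A ((hsymm (e s)).mapsToRestrict hmaps_symm) fun p => by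
      simp [heτ]⟩, fun _ => rfl⟩

end IsUniversalLeafSpace

end Uniqueness

theorem theorem3p1 (N n : ℕ) (hn : 1 ≤ n) (hnN : n ≤ N)
    (M₀ : Type u) [TopologicalSpace M₀] [T2Space M₀] [SecondCountableTopology M₀]
    [ChartedSpace (CSpace N) M₀] [IsManifold 𝓘(ℂ, CSpace N) ω M₀] :
    IsUniversalLeafSpace.{v, u, u} N n (GermSpace.proj : GermSpace N n M₀ → M₀) ∧
    (∀ s : GermSpace N n M₀, IsOpen (connectedComponent s)) ∧
    ∀ (X : Type u) [TopologicalSpace X] (τ : X → M₀),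
      IsUniversalLeafSpace.{u, u, u} N n τ →
      ∃ e : GermSpace N n M₀ → X,
        IsLeafEquivalence N n GermSpace.proj τ e ∧
        ((∀ x : X, IsOpen (connectedComponent x)) → IsHomeomorph e) :=
  ⟨GermSpace.isUniversalLeafSpace hnN, GermSpace.isOpen_connectedComponent hnN, fun _ _ _ hτ =>
    (GermSpace.isUniversalLeafSpace hnN).exists_isLeafEquivalence hτ
      (GermSpace.isOpen_connectedComponent hnN)⟩
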